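/- Theorem 3.3. Let $X$ be an order continuous Banach lattice (a real Banach lattice in which every net decreasing to $0$, i.e. decreasing with infimum $0$, converges to $0$ in norm), and let $X^*$ be its norm dual, which is a vector lattice for the order $\varphi\le\psi \iff \varphi(x)\le\psi(x)$ for all $x\ge 0$ in $X$. In a vector lattice $E$, a net $(x_\alpha)_{\alpha\in A}$ converges in order to $x$ if there is a net $(y_\beta)_{\beta\in B}$ in $E$, possibly with another index set, that decreases to $0$ and is such that for every $\beta\in B$ there is $\alpha_\beta\in A$ with $|x_\alpha-x|\le y_\beta$ for all $\alpha\ge\alpha_\beta$. The net is uo-convergent to $x$ if the net $(|x_\alpha-x|\wedge y)_{\alpha}$ converges in order to $0$ for every $y\ge 0$ in $E$. It is uo-Cauchy if the net $(x_\alpha-x_\beta)_{(\alpha,\beta)\in A\times A}$, where $A\times A$ carries the product order, is uo-convergent to $0$. (i) If $(\varphi_\alpha)$ is a uo-Cauchy net in $X^*$ that converges to $\varphi\in X^*$ in the weak$^*$ topology $\sigma(X^*,X)$, then $(\varphi_\alpha)$ is uo-convergent to $\varphi$ in $X^*$. (ii) If $(x_\alpha)$ is a uo-Cauchy net in $X$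 that converges weakly to $x\in X$, then $(x_\alpha)$ is uo-convergent to $x$ in $X$. -/

import Mathlib

open Filter Topology

universe u v w

/-! ### Order convergence and unbounded order convergence of nets

A net is a function on a nonempty directed preordered set. -/

section Convergence

variable {E : Type u} [AddCommGroup E] [Lattice E]

/-- The net `x` converges in order to `l`: there is a net `y` decreasing to `0` such that for
each `b` eventually `|x a - l| ≤ y b`. The index set of `y` may differ from that of `x`; it is taken
in the universe of `E`, which is no restriction, see `OrderConverges.of_net`. -/
def OrderConverges {A : Type v} [Preorder A] (x : A → E) (l : E) : Prop :=
  ∃ (B : Type u) (_ : Preorder B) (_ : IsDirectedOrder B) (_ : Nonempty B) (y : B → E),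
    Antitone y ∧ IsGLB (Set.range y) 0 ∧ ∀ b, ∃ a₀, ∀ a, a₀ ≤ a → |x a - l| ≤ y b

/-- Order convergence may be witnessed by a net `y` indexed in any universe. -/
theorem OrderConverges.of_net {A : Type v} [Preorder A] {x : A → E} {l : E}
    {B : Type w} [Preorder B] [IsDirectedOrder B] [Nonempty B] (y : B → E)
    (hy : Antitone y) (hy0 : IsGLB (Set.range y) 0)
    (h : ∀ b, ∃ a₀, ∀ a, a₀ ≤ a → |x a - l| ≤ y b) : OrderConverges x l := by
  refine ⟨(Set.range y)ᵒᵈ, inferInstance, ⟨?_⟩, ?_, fun d => (OrderDual.ofDual d).1, ?_, ?_, ?_⟩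
  · rintro ⟨_, b, rfl⟩ ⟨_, c, rfl⟩
    obtain ⟨d, hbd, hcd⟩ := exists_ge_ge b c
    exact ⟨OrderDual.toDual ⟨y d, d, rfl⟩, hy hbd, hy hcd⟩
  · exact ⟨OrderDual.toDual ⟨y (Classical.arbitrary B), _, rfl⟩⟩
  · exact fun a b hab => hab
  · convert hy0 using 1
    ext z
    constructor
    · rintro ⟨d, rfl⟩
      exact (OrderDual.ofDual d).2
    · intro hz
      exact ⟨OrderDual.toDual ⟨z, hz⟩, rfl⟩
  · rintro ⟨_, b, rfl⟩
    exact h b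

/-- The net `x` converges in unbounded order to `l`: `|x a - l| ⊓ y` converges in order to `0` for
every `y ≥ 0`. -/
def UOConverges {A : Type v} [Preorder A] (x : A → E) (l : E) : Prop :=
  ∀ y : E, 0 ≤ y → OrderConverges (fun a => |x a - l| ⊓ y) 0

/-- The net `x` is uo-Cauchy: the net `x a - x b`, indexed by pairs `(a, b)` with the product order,
converges in unbounded order to `0`. -/
def UOCauchy {A : Type v} [Preorder A] (x : A → E) : Prop :=
  UOConverges (fun p : A × A => x p.1 - x p.2) 0

end Convergence

/-- The norm of `E` is order continuous: every net decreasing to `0` converges to `0` in norm. -/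
def HasOrderContinuousNorm (E : Type u) [NormedAddCommGroup E] [Lattice E] : Prop :=
  ∀ (B : Type u) [Preorder B] [IsDirectedOrder B] [Nonempty B] (y : B → E),
    Antitone y → IsGLB (Set.range y) 0 → Tendsto (fun b => ‖y b‖) atTop (𝓝 0)

/-! ### The norm dual as a vector lattice

The dual of a normed vector lattice carries the order `φ ≤ ψ ↔ ∀ x ≥ 0, φ x ≤ ψ x`. It is a lattice
for this order, the positive part being given by the Riesz-Kantorovich formula. -/

namespace BanachLatticeDual

variable {X : Type u} [NormedAddCommGroup X] [NormedSpace ℝ X] [Lattice X] [HasSolidNorm X]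
  [IsOrderedAddMonoid X] [IsOrderedModule ℝ X]

/-- The value at `x ≥ 0` of the positive part of `φ`. -/
noncomputable def rk (φ : StrongDual ℝ X) (x : X) : ℝ := sSup (φ '' Set.Icc 0 x)

theorem apply_le_bound (φ : StrongDual ℝ X) {x y : X} (hy : y ∈ Set.Icc 0 x) :
    φ y ≤ ‖φ‖ * ‖x‖ := by
  have h1 : ‖y‖ ≤ ‖x‖ := norm_le_norm_of_abs_le_abs (by
    rw [abs_of_nonneg hy.1, abs_of_nonneg (hy.1.trans hy.2)]; exact hy.2)
  exact (le_abs_self _).trans ((φ.le_opNorm y).trans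
    (mul_le_mul_of_nonneg_left h1 (norm_nonneg φ)))

theorem le_rk (φ : StrongDual ℝ X) {x y : X} (hy : y ∈ Set.Icc 0 x) : φ y ≤ rk φ x :=
  le_csSup ⟨‖φ‖ * ‖x‖, by rintro _ ⟨z, hz, rfl⟩; exact apply_le_bound φ hz⟩ ⟨y, hy, rfl⟩

theorem rk_le (φ : StrongDual ℝ X) {x : X} (hx : 0 ≤ x) {c : ℝ}
    (h : ∀ y ∈ Set.Icc 0 x, φ y ≤ c) : rk φ x ≤ c :=
  csSup_le ⟨φ 0, 0, ⟨le_rfl, hx⟩, rfl⟩ (by rintro _ ⟨z, hz, rfl⟩; exact h z hz)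

theorem rk_nonneg (φ : StrongDual ℝ X) {x : X} (hx : 0 ≤ x) : 0 ≤ rk φ x := by
  simpa using le_rk φ (x := x) (y := 0) ⟨le_rfl, hx⟩

theorem rk_add (φ : StrongDual ℝ X) {x z : X} (hx : 0 ≤ x) (hz : 0 ≤ z) :
    rk φ (x + z) = rk φ x + rk φ z := by
  apply le_antisymm
  · refine rk_le φ (add_nonneg hx hz) fun y hy => ?_
    have h1 : y ⊓ x ∈ Set.Icc 0 x := ⟨le_inf hy.1 hx, inf_le_right⟩
    have h2 : y - y ⊓ x ∈ Set.Icc 0 z := by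
      refine ⟨sub_nonneg.2 inf_le_left, ?_⟩
      rw [sub_le_iff_le_add, ← sub_le_iff_le_add']
      exact le_inf (sub_le_self y hz) (sub_le_iff_le_add.2 hy.2)
    have h3 := le_rk φ h1
    have h4 := le_rk φ h2
    rw [map_sub] at h4
    linarith
  · rw [← le_sub_iff_add_le]
    refine rk_le φ hx fun y hy => ?_
    rw [le_sub_comm]
    refine rk_le φ hz fun w hw => ?_
    have := le_rk φ (x := x + z) (y := y + w)
      ⟨add_nonneg hy.1 hw.1, add_le_add hy.2 hw.2⟩
    rw [map_add] at this
    linarith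

theorem rk_smul (φ : StrongDual ℝ X) {c : ℝ} (hc : 0 < c) {x : X} (hx : 0 ≤ x) :
    rk φ (c • x) = c * rk φ x := by
  have key : ∀ (c : ℝ), 0 < c → ∀ x : X, 0 ≤ x → c * rk φ x ≤ rk φ (c • x) := by
    intro c hc x hx
    rw [← le_div_iff₀' hc]
    refine rk_le φ hx fun y hy => ?_
    rw [le_div_iff₀' hc]
    have := le_rk φ (x := c • x) (y := c • y)
      ⟨smul_nonneg hc.le hy.1, smul_le_smul_of_nonneg_left hy.2 hc.le⟩
    simpa using this
  refine le_antisymm ?_ (key c hc x hx)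
  have := key c⁻¹ (inv_pos.2 hc) (c • x) (smul_nonneg hc.le hx)
  rw [inv_smul_smul₀ hc.ne'] at this
  rwa [inv_mul_le_iff₀ hc] at this

/-- The linear extension of `rk φ` from the positive cone. -/
noncomputable def rkExt (φ : StrongDual ℝ X) (x : X) : ℝ := rk φ x⁺ - rk φ x⁻

theorem rkExt_sub (φ : StrongDual ℝ X) {a b : X} (ha : 0 ≤ a) (hb : 0 ≤ b) :
    rkExt φ (a - b) = rk φ a - rk φ b := by
  have h : (a - b)⁺ + b = a + (a - b)⁻ := by
    have := posPart_sub_negPart (a - b)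
    rw [sub_eq_sub_iff_add_eq_add] at this
    exact this
  have h2 := congrArg (rk φ) h
  rw [rk_add φ (posPart_nonneg _) hb, rk_add φ ha (negPart_nonneg _)] at h2
  unfold rkExt
  linarith

theorem rkExt_of_nonneg (φ : StrongDual ℝ X) {x : X} (hx : 0 ≤ x) : rkExt φ x = rk φ x := by
  have h0 : rk φ (0 : X) = 0 := by simpa using rk_add φ (le_refl (0 : X)) (le_refl (0 : X))
  simpa [h0] using rkExt_sub φ hx (le_refl (0 : X))

/-- The positive part of `φ` as a continuous linear functional. -/
noncomputable def posPartDual (φ : StrongDual ℝ X) : StrongDual ℝ X :=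
  LinearMap.mkContinuous
    { toFun := rkExt φ
      map_add' := fun x y => by
        have h : x + y = (x⁺ + y⁺) - (x⁻ + y⁻) := by
          conv_lhs => rw [← posPart_sub_negPart x, ← posPart_sub_negPart y]
          abel
        rw [h, rkExt_sub φ (add_nonneg (posPart_nonneg _) (posPart_nonneg _))
          (add_nonneg (negPart_nonneg _) (negPart_nonneg _)),
          rk_add φ (posPart_nonneg _) (posPart_nonneg _),
          rk_add φ (negPart_nonneg _) (negPart_nonneg _)]
        unfold rkExt
        ring
      map_smul' := fun c x => by
        have hp := posPart_nonneg x
        have hn := negPart_nonneg x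
        simp only [RingHom.id_apply, smul_eq_mul]
        rcases lt_trichotomy c 0 with hc | rfl | hc
        · have h : c • x = (-c) • x⁻ - (-c) • x⁺ := by
            conv_lhs => rw [← posPart_sub_negPart x]
            module
          have hc' : 0 < -c := neg_pos.2 hc
          rw [h, rkExt_sub φ (smul_nonneg hc'.le hn) (smul_nonneg hc'.le hp),
            rk_smul φ hc' hn, rk_smul φ hc' hp]
          unfold rkExt
          ring
        · rw [zero_smul, zero_mul]
          simpa using rkExt_sub φ (le_refl (0 : X)) (le_refl (0 : X))
        · have h : c • x = c • x⁺ - c • x⁻ := by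
            conv_lhs => rw [← posPart_sub_negPart x]
            module
          rw [h, rkExt_sub φ (smul_nonneg hc.le hp) (smul_nonneg hc.le hn),
            rk_smul φ hc hn, rk_smul φ hc hp]
          unfold rkExt
          ring }
    ‖φ‖ (fun x => by
      have hb : ∀ y : X, 0 ≤ y → |y| ≤ |x| → rk φ y ≤ ‖φ‖ * ‖x‖ := fun y hy hyx =>
        (rk_le φ hy fun z hz => apply_le_bound φ hz).trans
          (mul_le_mul_of_nonneg_left (norm_le_norm_of_abs_le_abs hyx) (norm_nonneg φ))
      have hp := hb x⁺ (posPart_nonneg x) (by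
        rw [abs_of_nonneg (posPart_nonneg x)]
        exact sup_le (le_abs_self x) (abs_nonneg x))
      have hn := hb x⁻ (negPart_nonneg x) (by
        rw [abs_of_nonneg (negPart_nonneg x)]
        exact sup_le (neg_le_abs x) (abs_nonneg x))
      have hp0 := rk_nonneg φ (posPart_nonneg x)
      have hn0 := rk_nonneg φ (negPart_nonneg x)
      change |rk φ x⁺ - rk φ x⁻| ≤ _
      exact abs_le.2 ⟨by linarith, by linarith⟩)

theorem posPartDual_apply (φ : StrongDual ℝ X) {x : X} (hx : 0 ≤ x) :
    posPartDual φ x = sSup (φ '' Set.Icc 0 x) :=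
  rkExt_of_nonneg φ hx

/-- The order of the dual: `φ ≤ ψ` if `φ x ≤ ψ x` for every `x ≥ 0`. -/
instance instPartialOrder : PartialOrder (StrongDual ℝ X) where
  le φ ψ := ∀ x : X, 0 ≤ x → φ x ≤ ψ x
  le_refl _ _ _ := le_rfl
  le_trans _ _ _ h₁ h₂ x hx := (h₁ x hx).trans (h₂ x hx)
  le_antisymm φ ψ h₁ h₂ := by
    have h : ∀ x : X, 0 ≤ x → φ x = ψ x := fun x hx => le_antisymm (h₁ x hx) (h₂ x hx)
    refine ContinuousLinearMap.ext fun x => ?_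
    rw [← posPart_sub_negPart x, map_sub, map_sub, h _ (posPart_nonneg x),
      h _ (negPart_nonneg x)]

theorem le_def {φ ψ : StrongDual ℝ X} : φ ≤ ψ ↔ ∀ x : X, 0 ≤ x → φ x ≤ ψ x := Iff.rfl

instance instIsOrderedAddMonoid : IsOrderedAddMonoid (StrongDual ℝ X) where
  add_le_add_left φ ψ h χ x hx := by
    simpa using h x hx

instance instIsOrderedModule : IsOrderedModule ℝ (StrongDual ℝ X) where
  smul_le_smul_of_nonneg_left c hc φ ψ h x hx := by
    simpa using mul_le_mul_of_nonneg_left (h x hx) hc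
  smul_le_smul_of_nonneg_right φ hφ c d h x hx := by
    simpa using mul_le_mul_of_nonneg_right h (by simpa using hφ x hx)

theorem le_posPartDual (φ : StrongDual ℝ X) : φ ≤ posPartDual φ := fun x hx => by
  rw [posPartDual_apply φ hx]
  exact le_rk φ ⟨hx, le_rfl⟩

theorem posPartDual_nonneg (φ : StrongDual ℝ X) : 0 ≤ posPartDual φ := fun x hx => by
  rw [posPartDual_apply φ hx]
  exact rk_nonneg φ hx

theorem posPartDual_le {φ ψ : StrongDual ℝ X} (h : φ ≤ ψ) (h0 : 0 ≤ ψ) :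
    posPartDual φ ≤ ψ := fun x hx => by
  rw [posPartDual_apply φ hx]
  refine rk_le φ hx fun y hy => (h y hy.1).trans ?_
  have := h0 (x - y) (sub_nonneg.2 hy.2)
  rw [map_sub] at this
  simpa using this

/-- The dual is a lattice, with `φ ⊔ ψ = ψ + (φ - ψ)⁺` and `φ ⊓ ψ = φ - (φ - ψ)⁺`. -/
noncomputable instance instLattice : Lattice (StrongDual ℝ X) where
  __ := instPartialOrder
  sup φ ψ := ψ + posPartDual (φ - ψ)
  inf φ ψ := φ - posPartDual (φ - ψ)
  le_sup_left φ ψ := sub_le_iff_le_add'.1 (le_posPartDual (φ - ψ))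
  le_sup_right φ ψ := le_add_of_nonneg_right (posPartDual_nonneg _)
  sup_le φ ψ χ h₁ h₂ := by
    rw [← le_sub_iff_add_le']
    exact posPartDual_le (sub_le_sub_right h₁ ψ) (sub_nonneg.2 h₂)
  inf_le_left φ ψ := sub_le_self φ (posPartDual_nonneg _)
  inf_le_right φ ψ := sub_le_comm.1 (le_posPartDual (φ - ψ))
  le_inf χ φ ψ h₁ h₂ := by
    rw [le_sub_comm]
    exact posPartDual_le (sub_le_sub_left h₂ φ) (sub_nonneg.2 h₁)

end BanachLatticeDual

/-! Fix `a` in `|x a - x b| ⊓ y ≤ w` and let `b` run to the limit: if the sets `{z | |z| ⊓ y ≤ w}`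
are closed for the topology at hand, the dominating net of the Cauchy condition also witnesses
uo-convergence. In `X` these sets are convex and norm closed, hence weakly closed.

In the dual, weak* closedness comes from order continuity of the norm. Put `θ = (η - w)⁺`. Then `|ψ|
⊓ η ≤ w` makes `(|ψ| - w)⁺` disjoint from `θ`, and disjoint positive functionals have disjoint
carriers, so `|ψ| ≤ w` on the carrier of `θ`. Conversely, where `θ` vanishes `η ≤ w`, and each
positive vector splits into a null and a carrier part (`exists_memCarrier_sub`). So the set is cut
out by inequalities `ψ z ≤ w |z|`, each weak* closed (`abs_inf_le_iff`). -/

/-! ### Vector lattices -/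

section UnboundedOrder

variable {E : Type u} [AddCommGroup E] [Lattice E] [IsOrderedAddMonoid E]

/-- If the sets `{z | |z| ⊓ y ≤ w}` are closed under passing to the limit `l` of the translated
nets `c - x a`, then a uo-Cauchy net `x` is uo-convergent to `l`. -/
theorem UOCauchy.uoConverges_of_closed {A : Type v} [Preorder A] [IsDirectedOrder A]
    {x : A → E} {l : E} (hx : UOCauchy x)
    (hcl : ∀ y w c : E, 0 ≤ y → 0 ≤ w → (∃ a₀, ∀ a, a₀ ≤ a → |c - x a| ⊓ y ≤ w) →
      |c - l| ⊓ y ≤ w) :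
    UOConverges x l := by
  intro y hy
  obtain ⟨B, _, _, _, w, hw, hw0, h⟩ := hx y hy
  refine ⟨B, _, ‹_›, ‹_›, w, hw, hw0, fun b => ?_⟩
  obtain ⟨⟨p, q⟩, hpq⟩ := h b
  obtain ⟨a₀, hp, hq⟩ := exists_ge_ge p q
  refine ⟨a₀, fun a ha => ?_⟩
  have hw_nonneg : 0 ≤ w b := hw0.1 ⟨b, rfl⟩
  rw [sub_zero, abs_of_nonneg (le_inf (abs_nonneg _) hy)]
  -- The first index stays fixed at `a`; only the second passes to the limit.
  refine hcl y (w b) (x a) hy hw_nonneg ⟨a₀, fun c hc => ?_⟩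
  have := hpq (a, c) ⟨hp.trans ha, hq.trans hc⟩
  simpa only [sub_zero, abs_of_nonneg (le_inf (abs_nonneg _) hy)] using this

theorem convex_setOf_abs_inf_le [Module ℝ E] [IsOrderedModule ℝ E] (y w : E) :
    Convex ℝ {z : E | |z| ⊓ y ≤ w} := by
  let _ : DistribLattice E := AddCommGroup.toDistribLattice E
  intro a ha b hb s t hs ht hst
  have h : |s • a + t • b| ≤ |a| ⊔ |b| := by
    have hle : ∀ {c : E}, c ≤ |a| ⊔ |b| → ∀ {r : ℝ}, 0 ≤ r → r • c ≤ r • (|a| ⊔ |b|) :=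
      fun hc _ hr => smul_le_smul_of_nonneg_left hc hr
    have hsum : s • (|a| ⊔ |b|) + t • (|a| ⊔ |b|) = |a| ⊔ |b| := by
      rw [← add_smul, hst, one_smul]
    refine abs_le'.2 ⟨?_, ?_⟩
    · rw [← hsum]
      exact add_le_add (hle ((le_abs_self a).trans le_sup_left) hs)
        (hle ((le_abs_self b).trans le_sup_right) ht)
    · rw [neg_add, ← smul_neg, ← smul_neg, ← hsum]
      exact add_le_add (hle ((neg_le_abs a).trans le_sup_left) hs)
        (hle ((neg_le_abs b).trans le_sup_right) ht)
  calc |s • a + t • b| ⊓ y ≤ (|a| ⊔ |b|) ⊓ y := inf_le_inf_right y h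
    _ = |a| ⊓ y ⊔ |b| ⊓ y := inf_sup_right _ _ _
    _ ≤ w := sup_le ha hb

/-- By distributivity the left side is `(a ⊓ b - c)⁺`. -/
theorem posPart_sub_inf_posPart_sub {a b c : E} (h : a ⊓ b ≤ c) :
    (a - c)⁺ ⊓ (b - c)⁺ = 0 := by
  let _ : DistribLattice E := AddCommGroup.toDistribLattice E
  have h1 : (a - c) ⊓ (b - c) ≤ 0 := by
    rw [← inf_sub]
    exact sub_nonpos.2 h
  rw [posPart_def, posPart_def, ← sup_inf_right]
  exact sup_eq_right.2 h1

end UnboundedOrder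

/-! ### Weak limits and order continuous norms -/

section NormedLattice

variable {X : Type u} [NormedAddCommGroup X] [Lattice X] [HasSolidNorm X]
  [IsOrderedAddMonoid X]

theorem isClosed_setOf_abs_inf_le (y w : X) : IsClosed {z : X | |z| ⊓ y ≤ w} := by
  have h : Continuous fun z : X => |z| ⊓ y :=
    (continuous_id.sup continuous_neg).inf continuous_const
  exact isClosed_le h continuous_const

variable [NormedSpace ℝ X] [IsOrderedModule ℝ X]

/-- Mazur: a norm closed convex set is weakly closed. -/
theorem abs_sub_inf_le_of_tendsto_toWeakSpace {A : Type v} [Preorder A] [IsDirectedOrder A]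
    [Nonempty A] {x : A → X} {l : X}
    (hx : Tendsto (fun a => toWeakSpace ℝ X (x a)) atTop (𝓝 (toWeakSpace ℝ X l)))
    {y w c : X} (h : ∃ a₀, ∀ a, a₀ ≤ a → |c - x a| ⊓ y ≤ w) : |c - l| ⊓ y ≤ w := by
  have hclosed : IsClosed (toWeakSpace ℝ X '' {z : X | |z| ⊓ y ≤ w}) := by
    rw [← closure_eq_iff_isClosed, ← (convex_setOf_abs_inf_le y w).toWeakSpace_closure ℝ,
      (isClosed_setOf_abs_inf_le y w).closure_eq]
  have ht : Tendsto (fun a => toWeakSpace ℝ X (c - x a)) atTop (𝓝 (toWeakSpace ℝ X (c - l))) := by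
    simp only [map_sub]
    exact tendsto_const_nhds.sub hx
  obtain ⟨a₀, ha₀⟩ := h
  have hmem := hclosed.mem_of_tendsto ht (by
    filter_upwards [eventually_ge_atTop a₀] with a ha using ⟨_, ha₀ a ha, rfl⟩)
  obtain ⟨z, hz, hzeq⟩ := hmem
  rwa [← (toWeakSpace ℝ X).injective hzeq]

theorem le_zero_of_forall_nsmul_le {a b : X} (h : ∀ n : ℕ, n • a ≤ b) : a ≤ 0 := by
  have hlim : Tendsto (fun n : ℕ => (1 / ((n : ℝ) + 1)) • b) atTop (𝓝 ((0 : ℝ) • b)) :=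
    tendsto_one_div_add_atTop_nhds_zero_nat.smul_const b
  rw [zero_smul] at hlim
  refine ge_of_tendsto' hlim fun n => ?_
  have h1 := smul_le_smul_of_nonneg_left (h (n + 1)) (by positivity : 0 ≤ 1 / ((n : ℝ) + 1))
  rwa [← Nat.cast_smul_eq_nsmul ℝ, smul_smul, Nat.cast_add, Nat.cast_one,
    one_div_mul_cancel (by positivity), one_smul] at h1

namespace HasOrderContinuousNorm

variable [CompleteSpace X]

/-- In a Banach lattice with order continuous norm, increasing order bounded nets converge. -/
theorem exists_tendsto_of_monotone (hX : HasOrderContinuousNorm X) {A : Type v} [Preorder A]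
    [IsDirectedOrder A] [Nonempty A] {x : A → X} (hx : Monotone x)
    (hb : BddAbove (Set.range x)) : ∃ l, Tendsto x atTop (𝓝 l) := by
  -- The differences `u - x a`, with `u` an upper bound, decrease to `0`. Indexing by the range of
  -- `x` instead of `A` keeps the index set in the universe of `X`.
  let B := {u : Xᵒᵈ // OrderDual.ofDual u ∈ upperBounds (Set.range x)} × Set.range x
  have hB : IsDirectedOrder B := by
    refine ⟨?_⟩
    rintro ⟨⟨u, hu⟩, ⟨_, a, rfl⟩⟩ ⟨⟨v, hv⟩, ⟨_, b, rfl⟩⟩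
    obtain ⟨c, hac, hbc⟩ := exists_ge_ge a b
    exact ⟨⟨⟨u ⊔ v, fun z hz => le_inf (hu hz) (hv hz)⟩, ⟨x c, c, rfl⟩⟩,
      ⟨le_sup_left (a := u), hx hac⟩, ⟨le_sup_right (a := u), hx hbc⟩⟩
  obtain ⟨u₀, hu₀⟩ := hb
  have hne : Nonempty B :=
    ‹Nonempty A›.elim fun a => ⟨⟨⟨OrderDual.toDual u₀, hu₀⟩, ⟨x a, a, rfl⟩⟩⟩
  have hlim := hX B (fun p => OrderDual.ofDual p.1.1 - p.2.1) (fun p q hpq => sub_le_sub hpq.1 hpq.2) (by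
    constructor
    · rintro _ ⟨p, rfl⟩
      exact sub_nonneg.2 (p.1.2 p.2.2)
    · intro l hl
      have hl' : ∀ u ∈ upperBounds (Set.range x), ∀ a, l ≤ u - x a := fun u hu a =>
        hl ⟨⟨⟨OrderDual.toDual u, hu⟩, ⟨x a, a, rfl⟩⟩, rfl⟩
      -- Subtracting a lower bound `l` of the differences turns upper bounds into upper bounds;
      -- iterate and use the Archimedean property.
      have hstep : ∀ n : ℕ, u₀ - n • l ∈ upperBounds (Set.range x) := by
        intro n
        induction n with
        | zero => simpa using hu₀
        | succ n ih =>
          rintro _ ⟨a, rfl⟩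
          rw [succ_nsmul, ← sub_sub]
          exact le_sub_comm.1 (hl' _ ih a)
      obtain ⟨a⟩ := ‹Nonempty A›
      exact le_zero_of_forall_nsmul_le (b := u₀ - x a) fun n => le_sub_comm.1 (hstep n ⟨a, rfl⟩))
  refine CompleteSpace.complete (Metric.cauchy_iff.2 ⟨inferInstance, fun ε hε => ?_⟩)
  obtain ⟨⟨⟨u, hu⟩, ⟨_, a, rfl⟩⟩, hua⟩ := (hlim.eventually_lt_const (half_pos hε)).exists
  have hdist : ∀ b, a ≤ b → dist (x b) (x a) < ε / 2 := fun b hab => by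
    rw [dist_eq_norm]
    refine lt_of_le_of_lt (norm_le_norm_of_abs_le_abs ?_) hua
    have h1 : x b - x a ≤ OrderDual.ofDual u - x a := sub_le_sub_right (hu ⟨b, rfl⟩) _
    have h0 : 0 ≤ x b - x a := sub_nonneg.2 (hx hab)
    rwa [abs_of_nonneg h0, abs_of_nonneg (h0.trans h1)]
  refine ⟨x '' Set.Ici a, image_mem_map (Ici_mem_atTop a), ?_⟩
  rintro _ ⟨b, hb, rfl⟩ _ ⟨c, hc, rfl⟩
  linarith [dist_triangle_right (x b) (x c) (x a), hdist b hb, hdist c hc]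

theorem exists_tendsto_of_antitone (hX : HasOrderContinuousNorm X) {A : Type v} [Preorder A]
    [IsDirectedOrder A] [Nonempty A] {x : A → X} (hx : Antitone x)
    (hb : BddBelow (Set.range x)) : ∃ l, Tendsto x atTop (𝓝 l) := by
  obtain ⟨m, hm⟩ := hb
  obtain ⟨l, hl⟩ := hX.exists_tendsto_of_monotone (x := fun a => -x a)
    (fun a b hab => neg_le_neg (hx hab))
    ⟨-m, by rintro _ ⟨a, rfl⟩; exact neg_le_neg (hm ⟨a, rfl⟩)⟩
  exact ⟨-l, by simpa using hl.neg⟩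

end HasOrderContinuousNorm

end NormedLattice

/-! ### Functionals and their carriers -/

namespace BanachLatticeDual

variable {X : Type u} [NormedAddCommGroup X] [NormedSpace ℝ X] [Lattice X] [HasSolidNorm X]
  [IsOrderedAddMonoid X] [IsOrderedModule ℝ X]

theorem apply_mono {φ : StrongDual ℝ X} (hφ : 0 ≤ φ) {x y : X} (h : x ≤ y) : φ x ≤ φ y := by
  have := hφ (y - x) (sub_nonneg.2 h)
  rw [map_sub] at this
  simpa using this

theorem apply_nonneg {φ : StrongDual ℝ X} (hφ : 0 ≤ φ) {x : X} (h : 0 ≤ x) : 0 ≤ φ x := by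
  simpa using apply_mono hφ h

theorem apply_le_abs_apply_abs (φ : StrongDual ℝ X) (x : X) : φ x ≤ |φ| |x| := by
  have hp := le_abs_self φ x⁺ (posPart_nonneg x)
  have hn := neg_le_abs φ x⁻ (negPart_nonneg x)
  rw [← posPart_add_negPart x, map_add]
  conv_lhs => rw [← posPart_sub_negPart x, map_sub]
  simp only [neg_apply] at hn
  linarith

theorem abs_apply_le {φ : StrongDual ℝ X} {x : X} (hx : 0 ≤ x) {c : ℝ}
    (h : ∀ y, |y| ≤ x → φ y ≤ c) : |φ| x ≤ c := by
  have habs : |φ| x = -φ x + rk (φ - -φ) x := by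
    change (-φ + posPartDual (φ - -φ)) x = _
    rw [add_apply, posPartDual_apply _ hx]
    rfl
  rw [habs, neg_add_le_iff_le_add]
  refine rk_le _ hx fun y hy => ?_
  -- `|φ| = -φ + (2φ)⁺`, and `y ↦ 2y - x` maps `[0, x]` into `[-x, x]`.
  have h1 := h (y + y - x) (abs_le'.2
    ⟨sub_le_iff_le_add.2 (add_le_add hy.2 hy.2), by
      rw [neg_sub]; exact sub_le_self x (add_nonneg hy.1 hy.1)⟩)
  simp only [map_sub, map_add] at h1
  simp only [sub_apply, neg_apply]
  linarith

/-- Riesz-Kantorovich for infima: `(ρ ⊓ θ) x` is the infimum of `ρ (x - u) + θ u` over `u ∈ [0, x]`.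
-/
theorem exists_apply_sub_add_apply_lt {ρ θ : StrongDual ℝ X} (h : ρ ⊓ θ = 0) {x : X}
    (hx : 0 ≤ x) {ε : ℝ} (hε : 0 < ε) : ∃ u ∈ Set.Icc 0 x, ρ (x - u) + θ u < ε := by
  by_contra! hcon
  have h1 : posPartDual (ρ - θ) = ρ := (sub_eq_zero.1 h).symm
  have h2 : ρ x = rk (ρ - θ) x := by
    conv_lhs => rw [← h1, posPartDual_apply _ hx]
    rfl
  have h3 : rk (ρ - θ) x ≤ ρ x - ε := rk_le _ hx fun u hu => by
    have := hcon u hu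
    rw [map_sub] at this
    rw [sub_apply]
    linarith
  linarith

/-- `x` lies in the carrier of `θ`: the functional `θ` is strictly positive below `|x|`. -/
def MemCarrier (θ : StrongDual ℝ X) (x : X) : Prop :=
  ∀ n, 0 ≤ n → n ≤ |x| → θ n = 0 → n = 0

theorem MemCarrier.mono {θ : StrongDual ℝ X} {x y : X} (hy : MemCarrier θ y) (h : |x| ≤ |y|) :
    MemCarrier θ x :=
  fun n hn hnx => hy n hn (hnx.trans h)

variable [CompleteSpace X]

/-- Every positive element is the sum of a null element and a carrier element of `θ`. -/
theorem exists_memCarrier_sub (hX : HasOrderContinuousNorm X) {θ : StrongDual ℝ X} (hθ : 0 ≤ θ)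
    {x : X} (hx : 0 ≤ x) : ∃ n ∈ Set.Icc 0 x, θ n = 0 ∧ MemCarrier θ (x - n) := by
  -- Null elements below `x` are closed under `⊔`; their limit is the largest one.
  let D := {n : X // n ∈ Set.Icc 0 x ∧ θ n = 0}
  have hD : IsDirectedOrder D := by
    refine ⟨fun a b => ⟨⟨a.1 ⊔ b.1, ⟨a.2.1.1.trans le_sup_left, sup_le a.2.1.2 b.2.1.2⟩, ?_⟩,
      le_sup_left (a := a.1), le_sup_right (a := a.1)⟩⟩
    have h0 : 0 ≤ a.1 ⊔ b.1 := a.2.1.1.trans le_sup_left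
    refine le_antisymm ?_ (apply_nonneg hθ h0)
    have h1 : a.1 ⊔ b.1 ≤ a.1 + b.1 :=
      sup_le (le_add_of_nonneg_right b.2.1.1) (le_add_of_nonneg_left a.2.1.1)
    simpa [a.2.2, b.2.2] using apply_mono hθ h1
  have hne : Nonempty D := ⟨⟨0, ⟨le_rfl, hx⟩, map_zero θ⟩⟩
  have hmono : Monotone (Subtype.val : D → X) := fun _ _ h => h
  obtain ⟨n, hn⟩ := hX.exists_tendsto_of_monotone hmono
    ⟨x, by rintro _ ⟨d, rfl⟩; exact d.2.1.2⟩
  have hn0 : 0 ≤ n := ge_of_tendsto' hn fun d => d.2.1.1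
  have hnx : n ≤ x := le_of_tendsto' hn fun d => d.2.1.2
  have hθn : θ n = 0 := by
    refine tendsto_nhds_unique ((θ.continuous.tendsto n).comp hn) ?_
    exact tendsto_const_nhds.congr fun d => d.2.2.symm
  refine ⟨n, ⟨hn0, hnx⟩, hθn, fun m hm hmx hθm => le_antisymm ?_ hm⟩
  rw [abs_of_nonneg (sub_nonneg.2 hnx), le_sub_iff_add_le'] at hmx
  have := hmono.ge_of_tendsto hn
    ⟨n + m, ⟨add_nonneg hn0 hm, hmx⟩, by rw [map_add, hθn, hθm, add_zero]⟩
  simpa using this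

/-- If the norm is order continuous, disjoint positive functionals have disjoint carriers. -/
theorem apply_eq_zero_of_inf_eq_zero (hX : HasOrderContinuousNorm X) {ρ θ : StrongDual ℝ X}
    (hρ : 0 ≤ ρ) (hθ : 0 ≤ θ) (h : ρ ⊓ θ = 0) {x : X} (hx : 0 ≤ x) (hxθ : MemCarrier θ x) :
    ρ x = 0 := by
  have hpos : ∀ k : ℕ, (0 : ℝ) < (1 / 2) ^ k := fun k => by positivity
  -- A Borel-Cantelli argument: `θ (u k)` is summable, so the decreasing tail suprema `s n` tend to
  -- a `θ`-null element below `x`, which is `0`; yet `ρ x ≤ (1 / 2) ^ n + ρ (s n)`.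
  choose u hu hlt using fun k => exists_apply_sub_add_apply_lt h hx (hpos k)
  have hθu : ∀ k, θ (u k) ≤ (1 / 2) ^ k := fun k => by
    linarith [hlt k, apply_nonneg hρ (sub_nonneg.2 (hu k).2)]
  have hρu : ∀ k, ρ (x - u k) ≤ (1 / 2) ^ k := fun k => by
    linarith [hlt k, apply_nonneg hθ (hu k).1]
  -- the tail suprema of `u`
  have hsup : ∀ n m, partialSups (fun k => u (n + k)) m ≤ x := fun n m =>
    partialSups_le _ _ _ fun k _ => (hu (n + k)).2
  choose s hs using fun n => hX.exists_tendsto_of_monotone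
    (partialSups fun k => u (n + k)).monotone ⟨x, by rintro _ ⟨m, rfl⟩; exact hsup n m⟩
  have hus : ∀ n m, partialSups (fun k => u (n + k)) m ≤ s n := fun n m =>
    (partialSups fun k => u (n + k)).monotone.ge_of_tendsto (hs n) m
  have hus' : ∀ n k, u (n + k) ≤ s n := fun n k =>
    (le_partialSups (fun k => u (n + k)) k).trans (hus n k)
  have hsx : ∀ n, s n ≤ x := fun n => le_of_tendsto' (hs n) (hsup n)
  have hs0 : ∀ n, 0 ≤ s n := fun n => (hu n).1.trans (hus' n 0)
  have hanti : Antitone s := antitone_nat_of_succ_le fun n =>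
    le_of_tendsto' (hs (n + 1)) fun m => partialSups_le _ _ _ fun k _ => by
      have := hus' n (1 + k)
      rwa [← add_assoc] at this
  have hθs : ∀ n, θ (s n) ≤ 2 * (1 / 2) ^ n := by
    intro n
    refine le_of_tendsto' ((θ.continuous.tendsto _).comp (hs n)) fun m => ?_
    -- `2 - (1 / 2) ^ m` is the geometric sum `1 + ... + (1 / 2) ^ m`.
    have hb : ∀ m, θ (partialSups (fun k => u (n + k)) m) ≤ (2 - (1 / 2) ^ m) * (1 / 2) ^ n := by
      intro m
      induction m with
      | zero =>
        rw [partialSups_zero]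
        have := hθu n
        norm_num
        simpa using this
      | succ m ih =>
        rw [partialSups_add_one]
        have hm0 : 0 ≤ partialSups (fun k => u (n + k)) m :=
          (hu (n + 0)).1.trans (le_partialSups_of_le (fun k => u (n + k)) (Nat.zero_le m))
        have h1 := apply_mono hθ (sup_le (le_add_of_nonneg_right (hu (n + (m + 1))).1)
          (le_add_of_nonneg_left hm0))
        rw [map_add] at h1
        have h2 := hθu (n + (m + 1))
        rw [pow_add, pow_succ] at h2
        rw [pow_succ]
        linarith
    refine (hb m).trans ?_
    have := mul_pos (hpos m) (hpos n)
    linarith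
  obtain ⟨t, ht⟩ := hX.exists_tendsto_of_antitone hanti
    ⟨0, by rintro _ ⟨n, rfl⟩; exact hs0 n⟩
  have ht0 : 0 ≤ t := ge_of_tendsto' ht hs0
  have hgeom : Tendsto (fun n : ℕ => (1 / 2 : ℝ) ^ n) atTop (𝓝 0) :=
    tendsto_pow_atTop_nhds_zero_of_lt_one (by norm_num) (by norm_num)
  have htzero : t = 0 := by
    refine hxθ t ht0 ?_ (le_antisymm ?_ (apply_nonneg hθ ht0))
    · rw [abs_of_nonneg hx]
      exact le_of_tendsto' ht hsx
    · refine le_of_tendsto_of_tendsto' ((θ.continuous.tendsto _).comp ht) ?_ hθs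
      simpa using hgeom.const_mul 2
  rw [htzero] at ht
  refine le_antisymm ?_ (apply_nonneg hρ hx)
  have hlim : Tendsto (fun n => (1 / 2) ^ n + ρ (s n)) atTop (𝓝 (0 + ρ 0)) :=
    hgeom.add ((ρ.continuous.tendsto 0).comp ht)
  rw [map_zero, add_zero] at hlim
  refine ge_of_tendsto' hlim fun n => ?_
  have h1 := hρu n
  have h2 := apply_mono hρ (hus' n 0)
  rw [map_sub] at h1
  simp only [add_zero] at h2
  linarith

/-- If the norm is order continuous, `|ψ| ⊓ η ≤ w` means that `|ψ| ≤ w` on the carrier of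
`(η - w)⁺`. -/
theorem abs_inf_le_iff (hX : HasOrderContinuousNorm X) {ψ η w : StrongDual ℝ X}
    (hw : 0 ≤ w) :
    |ψ| ⊓ η ≤ w ↔ ∀ z, MemCarrier (η - w)⁺ z → ψ z ≤ w |z| := by
  constructor
  · intro h z hz
    have h0 := apply_eq_zero_of_inf_eq_zero hX (posPart_nonneg _) (posPart_nonneg _)
      (posPart_sub_inf_posPart_sub h) (abs_nonneg z) (hz.mono (abs_abs z).le)
    have h1 := le_posPart (|ψ| - w) |z| (abs_nonneg z)
    rw [h0, sub_apply] at h1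
    linarith [apply_le_abs_apply_abs ψ z]
  · intro h x hx
    -- Bound the infimum by `η` on `n` and by `|ψ|` on `x - n`.
    obtain ⟨n, hn, hθn, hc⟩ := exists_memCarrier_sub hX (posPart_nonneg (η - w)) hx
    have hxn : 0 ≤ x - n := sub_nonneg.2 hn.2
    have h1 : (|ψ| ⊓ η) n ≤ η n := inf_le_right (a := |ψ|) n hn.1
    have h2 : (|ψ| ⊓ η) (x - n) ≤ |ψ| (x - n) := inf_le_left (b := η) _ hxn
    have h3 := le_posPart (η - w) n hn.1
    rw [hθn, sub_apply] at h3
    have h4 : |ψ| (x - n) ≤ w (x - n) := abs_apply_le hxn fun y hy =>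
      (h y (hc.mono (by rwa [abs_of_nonneg hxn]))).trans (apply_mono hw hy)
    rw [map_sub] at h2
    rw [map_sub w] at h4
    linarith

theorem abs_sub_inf_le_of_tendsto_toWeakDual (hX : HasOrderContinuousNorm X) {A : Type v}
    [Preorder A] [IsDirectedOrder A] [Nonempty A] {φ : A → StrongDual ℝ X} {l : StrongDual ℝ X}
    (hφ : Tendsto (fun a => StrongDual.toWeakDual (φ a)) atTop (𝓝 (StrongDual.toWeakDual l)))
    {η w c : StrongDual ℝ X} (hw : 0 ≤ w)
    (h : ∃ a₀, ∀ a, a₀ ≤ a → |c - φ a| ⊓ η ≤ w) : |c - l| ⊓ η ≤ w := by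
  obtain ⟨a₀, ha₀⟩ := h
  refine (abs_inf_le_iff hX hw).2 fun z hz => ?_
  have hlim : Tendsto (fun a => φ a z) atTop (𝓝 (l z)) :=
    ((WeakDual.eval_continuous z).tendsto (StrongDual.toWeakDual l)).comp hφ
  refine le_of_tendsto (tendsto_const_nhds.sub hlim) ?_
  filter_upwards [eventually_ge_atTop a₀] with a ha
  exact (abs_inf_le_iff hX hw).1 (ha₀ a ha) z hz

end BanachLatticeDual

theorem theorem3p3 {X : Type u} [NormedAddCommGroup X] [NormedSpace ℝ X] [CompleteSpace X]
    [Lattice X] [HasSolidNorm X] [IsOrderedAddMonoid X] [IsOrderedModule ℝ X]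
    (hX : HasOrderContinuousNorm X) :
    (∀ (A : Type v) [Preorder A] [IsDirectedOrder A] [Nonempty A]
      (φ : A → StrongDual ℝ X) (φ₀ : StrongDual ℝ X),
      UOCauchy φ →
      Tendsto (fun a => StrongDual.toWeakDual (φ a)) atTop (𝓝 (StrongDual.toWeakDual φ₀)) →
      UOConverges φ φ₀) ∧
    (∀ (A : Type v) [Preorder A] [IsDirectedOrder A] [Nonempty A]
      (x : A → X) (x₀ : X),
      UOCauchy x →
      Tendsto (fun a => toWeakSpace ℝ X (x a)) atTop (𝓝 (toWeakSpace ℝ X x₀)) →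
      UOConverges x x₀) :=
  ⟨fun _ _ _ _ _ _ hC hφ => hC.uoConverges_of_closed fun _ _ _ _ hw =>
      BanachLatticeDual.abs_sub_inf_le_of_tendsto_toWeakDual hX hφ hw,
    fun _ _ _ _ _ _ hC hx => hC.uoConverges_of_closed fun _ _ _ _ _ =>
      abs_sub_inf_le_of_tendsto_toWeakSpace hx⟩
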